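/- Let $(\mathcal B,\|\cdot\|)$ be a real Banach space that is $(2,D)$-smooth for some $D>0$, i.e. $\|x+y\|^2+\|x-y\|^2\le 2\|x\|^2+2D^2\|y\|^2$ for all $x,y\in\mathcal B$. Let $1\le m<N$ be integers, let $v_1,\dots,v_N\in\mathcal B$ be vectors (not necessarily distinct), and put $\bar v=\frac1N\sum_{i=1}^N v_i$ and $R_v=\max_{1\le i\le N}\|v_i\|$. Let $V_1,\dots,V_m$ be obtained by uniform sampling without replacement from $v_1,\dots,v_N$: $V_k=v_{I_k}$, where $(I_1,\dots,I_m)$ is uniformly distributed over the $m$-tuples of pairwise distinct elements of $\{1,\dots,N\}$. Write $\mathbb E_{k-1}$ for the conditional expectation given $\sigma(V_1,\dots,V_{k-1})$ (so $\mathbb E_0$ is the expectation) and $$\sigma_m=\frac{1}{\sqrt{\sum_{k=1}^m\frac1{(N-k)^2}}}\;\Big\|\Big(\sum_{k=1}^m\frac{1}{(N-k)^2}\,\mathbb E_{k-1}\|V_k-\mathbb E_{k-1}V_k\|^2\Big)^{1/2}\Big\|_\infty ,$$ where $\|\cdot\|_\infty$ is the essential supremum norm. Then for every $\varepsilon>0$,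 $$\mathbb P\Big(\Big\|\frac1m\sum_{i=1}^m V_i-\bar v\Big\|\ge\varepsilon\Big)\le 2\exp\left(-\frac{m\varepsilon^2}{2\left(2D^2\frac{N-m}{N}\sigma_m^2+\varepsilon R_v/3\right)}\right),$$ where, if the denominator is $0$ (which happens only if all $v_i=0$), the right-hand side is read as $2$. -/

import Mathlib

open MeasureTheory ProbabilityTheory
open scoped ENNReal

noncomputable section

/-- The normed space `E` is `(2, D)`-smooth. -/
def IsTwoSmooth (E : Type*) [NormedAddCommGroup E] (D : ℝ) : Prop :=
  0 < D ∧ ∀ x y : E, ‖x + y‖ ^ 2 + ‖x - y‖ ^ 2 ≤ 2 * ‖x‖ ^ 2 + 2 * D ^ 2 * ‖y‖ ^ 2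

/-- `I 0, …, I (m - 1)` are the successive (random) labels obtained when `m` elements are drawn
uniformly without replacement from `N` labelled elements: the tuple of labels is uniformly
distributed over the `N (N - 1) ⋯ (N - m + 1)` injective tuples. -/
structure IsSamplingWithoutReplacement {Ω : Type*} [MeasurableSpace Ω] (μ : Measure Ω)
    {N m : ℕ} (I : Fin m → Ω → Fin N) : Prop where
  measurable : ∀ k, Measurable (I k)
  uniform : ∀ a : Fin m → Fin N, Function.Injective a →
    μ {ω | ∀ k, I k ω = a k} = ((N.descFactorial m : ℕ) : ℝ≥0∞)⁻¹

/-- The σ-algebra generated by the variables `V i` with `i < k`. The index `k : Fin m` is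
zero-based, so this is the information available just before `V k` is drawn; it is trivial
for `k = 0`. -/
@[reducible]
def pastSigma {Ω E : Type*} [NormedAddCommGroup E] {m : ℕ}
    (V : Fin m → Ω → E) (k : Fin m) : MeasurableSpace Ω :=
  ⨆ i : Fin m, ⨆ _ : i < k, MeasurableSpace.comap (V i) (borel E)

/-- The conditional variance `𝔼_{k-1} ‖V_k - 𝔼_{k-1} V_k‖²`, as a random variable. -/
def stepVariance {Ω E : Type*} [MeasurableSpace Ω] [NormedAddCommGroup E] [NormedSpace ℝ E]
    [CompleteSpace E] (μ : Measure Ω) {m : ℕ} (V : Fin m → Ω → E) (k : Fin m) : Ω → ℝ :=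
  μ[fun ω => ‖V k ω - (μ[V k | pastSigma V k]) ω‖ ^ 2 | pastSigma V k]

/-- The weight `1 / (N - k)²` of the `k`-th draw, where the one-based number of the draw
with zero-based index `k : Fin m` is `k + 1`. -/
def stepWeight (N : ℕ) {m : ℕ} (k : Fin m) : ℝ :=
  1 / ((N : ℝ) - ((k : ℕ) + 1 : ℝ)) ^ 2

/-- The standard deviation `σ_m` for sampling without replacement: the `L^∞` norm of the square
root of the weighted sum of the conditional variances, divided by the square root of the sum of
the weights. -/
def samplingSigma {Ω E : Type*} [MeasurableSpace Ω] [NormedAddCommGroup E] [NormedSpace ℝ E]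
    [CompleteSpace E] (μ : Measure Ω) (N : ℕ) {m : ℕ} (V : Fin m → Ω → E) : ℝ :=
  1 / √(∑ k : Fin m, stepWeight N k) *
    (eLpNorm (fun ω => √(∑ k : Fin m, stepWeight N k * stepVariance μ V k ω)) ∞ μ).toReal

end

/-!
The mean of the vectors not yet drawn is a martingale: given the past, the next draw is uniform on
the remaining vectors. Its displacement after `m` draws is `m / (N - m)` times the deviation of the
sample mean, and its predictable variation is the weighted sum of conditional variances in `σ_m`.

For a martingale `M` with values in a `(2, D)`-smooth space and increments bounded by `a`, Pinelis'
process `cosh ‖M_n‖ * exp (-κ ⟨M⟩_n)` with `κ = D ^ 2 * (exp a - 1 - a) / a ^ 2` is a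
supermartingale, because smoothness bounds `cosh ‖x + y‖` by `cosh ‖x‖ * (1 + κ ‖y‖ ^ 2)` plus a
term linear in `y`. Rescaling `M` and applying Markov's inequality gives a Bernstein inequality.

The increments here are controlled only through differences `‖v i - v j‖ ≤ 2 R`. The factor `2` does
not reach the final bound, because the Bernstein exponent may be weakened by dividing the variance
by some `c ∈ [1 / 2, 1]` while multiplying the range by `c`, still at an admissible exponential
rate, and the `σ_m` term of the theorem has a factor `2` to spare.
-/

theorem hasSum_exp_sub_one_sub_id (u : ℝ) :
    HasSum (fun k : ℕ => u ^ (k + 2) / ((k + 2).factorial : ℝ)) (Real.exp u - 1 - u) := by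
  have hexp : HasSum (fun k : ℕ => u ^ k / (k.factorial : ℝ)) (Real.exp u) := by
    rw [Real.exp_eq_exp_ℝ]
    exact NormedSpace.expSeries_div_hasSum_exp u
  simpa [Finset.sum_range_succ, sub_sub] using (hasSum_nat_add_iff' 2).mpr hexp

theorem exp_sub_one_sub_id_nonneg (u : ℝ) : 0 ≤ Real.exp u - 1 - u := by
  linarith [Real.add_one_le_exp u]

theorem sq_div_two_le_exp_sub_one_sub_id {u : ℝ} (hu : 0 ≤ u) :
    u ^ 2 / 2 ≤ Real.exp u - 1 - u := by
  linarith [Real.quadratic_le_exp_of_nonneg hu]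

theorem exp_sub_one_sub_id_le_sq_mul {u a : ℝ} (hu : 0 ≤ u) (hua : u ≤ a) (ha : 0 < a) :
    Real.exp u - 1 - u ≤ u ^ 2 * ((Real.exp a - 1 - a) / a ^ 2) := by
  refine hasSum_le (fun k => ?_) (hasSum_exp_sub_one_sub_id u)
    (((hasSum_exp_sub_one_sub_id a).div_const (a ^ 2)).mul_left (u ^ 2))
  calc u ^ (k + 2) / ((k + 2).factorial : ℝ)
      = u ^ 2 * (u ^ k / (k + 2).factorial) := by ring
    _ ≤ u ^ 2 * (a ^ k / (k + 2).factorial) := by gcongr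
    _ = u ^ 2 * (a ^ (k + 2) / (k + 2).factorial / a ^ 2) := by field_simp; ring

theorem exp_sub_one_sub_id_le_bernstein {θ : ℝ} (h0 : 0 ≤ θ) (h3 : θ < 3) :
    Real.exp θ - 1 - θ ≤ θ ^ 2 / (2 * (1 - θ / 3)) := by
  have hgeom := (hasSum_geometric_of_lt_one (r := θ / 3) (by positivity) (by linarith)).mul_left
    (θ ^ 2 / 2)
  rw [← div_eq_mul_inv, div_div] at hgeom
  refine hasSum_le (fun k => ?_) (hasSum_exp_sub_one_sub_id θ) hgeom
  have hfactorial : (2 : ℝ) * 3 ^ k ≤ ((k + 2).factorial : ℝ) := by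
    have := Nat.factorial_mul_pow_le_factorial (m := 2) (n := k)
    rw [add_comm 2 k] at this
    exact_mod_cast this
  calc θ ^ (k + 2) / ((k + 2).factorial : ℝ) ≤ θ ^ (k + 2) / (2 * 3 ^ k) := by gcongr
    _ = θ ^ 2 / 2 * (θ / 3) ^ k := by rw [div_pow, pow_add]; ring

theorem exists_bernstein_rate_le {t : ℝ} (ht : 0 < t) :
    ∃ θ : ℝ, 0 < θ ∧ t ^ 2 / (2 * (1 + t / 3)) ≤ θ * t - (Real.exp θ - 1 - θ) := by
  refine ⟨t / (1 + t / 3), by positivity, ?_⟩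
  have hlt : t / (1 + t / 3) < 3 := by
    rw [div_lt_iff₀ (by positivity)]
    linarith
  have hcompl : 1 - t / (1 + t / 3) / 3 = 1 / (1 + t / 3) := by field_simp; ring
  calc t ^ 2 / (2 * (1 + t / 3))
      = t / (1 + t / 3) * t - (t / (1 + t / 3)) ^ 2 / (2 * (1 - t / (1 + t / 3) / 3)) := by
        rw [hcompl]; field_simp; ring
    _ ≤ _ := by gcongr; exact exp_sub_one_sub_id_le_bernstein (by positivity) hlt

theorem exp_five_thirds_lt : Real.exp (5 / 3) < 5.3 := by
  refine lt_of_pow_lt_pow_left₀ 3 (by norm_num) ?_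
  calc Real.exp (5 / 3) ^ 3 = Real.exp 1 ^ 5 := by
        rw [← Real.exp_nat_mul, ← Real.exp_nat_mul]; norm_num
    _ < 2.7182818286 ^ 5 := by gcongr; exact Real.exp_one_lt_d9
    _ < 5.3 ^ 3 := by norm_num

theorem exp_three_lt : Real.exp 3 < 20.09 := by
  calc Real.exp 3 = Real.exp 1 ^ 3 := by rw [← Real.exp_nat_mul]; norm_num
    _ < 2.7182818286 ^ 3 := by gcongr; exact Real.exp_one_lt_d9
    _ < 20.09 := by norm_num

theorem sq_div_le_of_three_mul_cube_le {c t q : ℝ} (hc : 0 < c) (ht : 0 < t) (hq : 0 < q)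
    (h : 3 * t ^ 3 ≤ 16 * q ^ 2) : t ^ 2 / (2 * (1 / c + c * t / 3)) ≤ q := by
  -- AM-GM: the denominator is at least `4 * √(t / 3)`
  have hamgm : 16 * t / 3 ≤ (2 * (1 / c + c * t / 3)) ^ 2 := by
    have : (2 * (1 / c + c * t / 3)) ^ 2 = 4 * (1 / c - c * t / 3) ^ 2 + 16 * t / 3 := by
      field_simp; ring
    rw [this]
    linarith [sq_nonneg (1 / c - c * t / 3)]
  rw [div_le_iff₀ (by positivity)]
  refine le_of_sq_le_sq ?_ (by positivity)
  nlinarith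

theorem sq_div_le_three_mul_sub {c t : ℝ} (hc : 1 / 2 ≤ c) (ht : 10.75 ≤ t) :
    t ^ 2 / (2 * (1 / c + c * t / 3)) ≤ 3 * t - 16.09 := by
  have hc0 : 0 < c := by linarith
  have : 0 < t := by linarith
  rw [div_le_iff₀ (by positivity), show (3 * t - 16.09) * (2 * (1 / c + c * t / 3))
    = (3 * t - 16.09) * (2 + 2 * c ^ 2 * t / 3) / c by field_simp, le_div_iff₀ hc0]
  have hhalf : t ^ 2 / 2 ≤ (3 * t - 16.09) * (2 + t / 6) := by nlinarith
  have hslope : t ^ 2 ≤ 2 * t / 3 * (3 * t - 16.09) * (c + 1 / 2) :=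
    calc t ^ 2 ≤ 2 * t / 3 * (3 * t - 16.09) * 1 := by nlinarith
      _ ≤ _ := by
        have : 0 ≤ 2 * t / 3 * (3 * t - 16.09) := mul_nonneg (by positivity) (by linarith)
        gcongr
        linarith
  nlinarith [hhalf, mul_nonneg (sub_nonneg.2 hc) (sub_nonneg.2 hslope)]

/-- For `t ≤ 3` the classical rate of the case `c = 1` still works, since lowering `c` only weakens
the left-hand side. For larger `t` the tangent lines at the rates `5 / 3` and `3` to the Legendre
transform of `exp u - 1 - u` lie high enough, for all `c` at once. -/
theorem exists_interpolated_bernstein_rate_le {c t : ℝ} (hc : 1 / 2 ≤ c) (hc1 : c ≤ 1)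
    (ht : 0 < t) :
    ∃ θ : ℝ, 0 < θ ∧ t ^ 2 / (2 * (1 / c + c * t / 3)) ≤ θ * t - (Real.exp θ - 1 - θ) := by
  have hc0 : 0 < c := by linarith
  rcases le_or_gt t 3 with hsmall | hmid
  · obtain ⟨θ, hθ, hrate⟩ := exists_bernstein_rate_le ht
    refine ⟨θ, hθ, le_trans ?_ hrate⟩
    have : 1 + t / 3 ≤ 1 / c + c * t / 3 := by
      have hfactor : 1 / c + c * t / 3 - (1 + t / 3) = (1 - c) * (1 / c - t / 3) := by
        field_simp; ring
      have : 1 ≤ 1 / c := by rwa [one_le_div hc0]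
      nlinarith
    gcongr
  rcases le_or_gt t 10.75 with hmid' | hlarge
  · refine ⟨5 / 3, by norm_num, ?_⟩
    have htangent : 5 / 3 * t - 79 / 30 ≤ 5 / 3 * t - (Real.exp (5 / 3) - 1 - 5 / 3) := by
      linarith [exp_five_thirds_lt]
    refine (sq_div_le_of_three_mul_cube_le hc0 ht (by linarith) ?_).trans htangent
    nlinarith [mul_nonneg (mul_nonneg (sub_nonneg.2 hmid.le) (sub_nonneg.2 hmid')) ht.le]
  · refine ⟨3, by norm_num, (sq_div_le_three_mul_sub hc hlarge.le).trans ?_⟩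
    linarith [exp_three_lt]

theorem exists_scaled_bernstein_rate_le {a b c r : ℝ} (ha : 0 < a) (hb : 0 ≤ b) (hr : 0 < r)
    (hc : 1 / 2 ≤ c) (hc1 : c ≤ 1) :
    ∃ s : ℝ, 0 < s ∧ r ^ 2 / (2 * (b / c + c * a * r / 3))
      ≤ s * r - b * ((Real.exp (s * a) - 1 - s * a) / a ^ 2) := by
  obtain rfl | hb := hb.eq_or_lt
  · have : 0 < c := by linarith
    refine ⟨r / (2 * (0 / c + c * a * r / 3)), by positivity, le_of_eq ?_⟩
    ring
  obtain ⟨θ, hθ, hrate⟩ := exists_interpolated_bernstein_rate_le hc hc1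
    (t := r * a / b) (by positivity)
  refine ⟨θ / a, by positivity, ?_⟩
  rw [div_mul_cancel₀ θ ha.ne']
  calc r ^ 2 / (2 * (b / c + c * a * r / 3))
      = b / a ^ 2 * ((r * a / b) ^ 2 / (2 * (1 / c + c * (r * a / b) / 3))) := by field_simp
    _ ≤ b / a ^ 2 * (θ * (r * a / b) - (Real.exp θ - 1 - θ)) := by gcongr
    _ = θ / a * r - b * ((Real.exp θ - 1 - θ) / a ^ 2) := by field_simp

theorem cosh_le_chord {r a ρ w : ℝ} (hw0 : 0 ≤ w) (hw1 : w ≤ 1)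
    (hρ : ρ ^ 2 = (1 - w) * (r - a) ^ 2 + w * (r + a) ^ 2) :
    Real.cosh ρ ≤ (1 - w) * Real.cosh (r - a) + w * Real.cosh (r + a) := by
  -- the power series of `cosh` has nonnegative coefficients, so `cosh ∘ √` is convex termwise
  refine hasSum_le (fun k => ?_) (Real.hasSum_cosh ρ)
    (((Real.hasSum_cosh (r - a)).mul_left (1 - w)).add ((Real.hasSum_cosh (r + a)).mul_left w))
  have hpow := (convexOn_pow (𝕜 := ℝ) k).2 (x := (r - a) ^ 2) (y := (r + a) ^ 2)
    (Set.mem_Ici.2 (sq_nonneg _)) (Set.mem_Ici.2 (sq_nonneg _)) (sub_nonneg.2 hw1) hw0 (by ring)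
  simp only [smul_eq_mul] at hpow
  rw [← hρ] at hpow
  simp only [pow_mul, ← mul_div_assoc, ← add_div]
  gcongr

theorem sinh_le_mul_cosh {r : ℝ} (hr : 0 ≤ r) : Real.sinh r ≤ r * Real.cosh r := by
  have hderiv (x : ℝ) : HasDerivAt (fun x => x * Real.cosh x - Real.sinh x)
      (x * Real.sinh x) x := by
    refine (((hasDerivAt_id x).mul (Real.hasDerivAt_cosh x)).sub
      (Real.hasDerivAt_sinh x)).congr_deriv ?_
    simp
  have hmono : MonotoneOn (fun x => x * Real.cosh x - Real.sinh x) (Set.Ici (0 : ℝ)) := by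
    refine monotoneOn_of_deriv_nonneg (convex_Ici 0) (by fun_prop)
      (fun x _ => (hderiv x).differentiableAt.differentiableWithinAt) fun x hx => ?_
    rw [interior_Ici] at hx
    rw [(hderiv x).deriv]
    exact mul_nonneg hx.le (Real.sinh_nonneg_iff.2 hx.le)
  simpa using hmono Set.self_mem_Ici hr hr

theorem mul_sinh_le_cosh_mul {r δ b : ℝ} (hr : 0 ≤ r) (hb : 0 ≤ b) (h : r * δ ≤ b) :
    δ * Real.sinh r ≤ Real.cosh r * b := by
  rcases le_total δ 0 with hδ | hδ
  · exact (mul_nonpos_of_nonpos_of_nonneg hδ (Real.sinh_nonneg_iff.2 hr)).trans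
      (mul_nonneg (Real.cosh_pos r).le hb)
  · calc δ * Real.sinh r ≤ δ * (r * Real.cosh r) := by gcongr; exact sinh_le_mul_cosh hr
      _ = Real.cosh r * (r * δ) := by ring
      _ ≤ Real.cosh r * b := by gcongr

theorem cosh_le_of_sq_eq {r a g ρ : ℝ} (hr : 0 ≤ r) (ha : 0 < a) (hg : |g| ≤ a)
    (hρ : ρ ^ 2 = r ^ 2 + a ^ 2 + 2 * r * g) :
    Real.cosh ρ ≤ Real.cosh r * (Real.exp a - a) + g * Real.sinh r := by
  obtain ⟨hlow, hup⟩ : -1 ≤ g / a ∧ g / a ≤ 1 := by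
    rw [← abs_le, abs_div, abs_of_pos ha]
    exact div_le_one_of_le₀ hg ha.le
  have hchord : Real.cosh ρ ≤ Real.cosh r * Real.cosh a + g / a * Real.sinh r * Real.sinh a := by
    have := cosh_le_chord (r := r) (a := a) (ρ := ρ) (w := (1 + g / a) / 2) (by linarith)
      (by linarith) (by rw [hρ]; field_simp; ring)
    rw [Real.cosh_add, Real.cosh_sub] at this
    linarith
  have hsinh : g / a * Real.sinh r ≤ Real.cosh r :=
    (mul_le_of_le_one_left (Real.sinh_nonneg_iff.2 hr) hup).trans (Real.sinh_lt_cosh r).le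
  have hgap : 0 ≤ Real.sinh a - a := sub_nonneg.2 (Real.self_le_sinh_iff.2 ha.le)
  calc Real.cosh ρ
      ≤ Real.cosh r * Real.cosh a + g / a * Real.sinh r * (Real.sinh a - a)
        + g / a * Real.sinh r * a := by linarith
    _ ≤ Real.cosh r * Real.cosh a + Real.cosh r * (Real.sinh a - a)
        + g / a * Real.sinh r * a := by gcongr
    _ = Real.cosh r * (Real.exp a - a) + g * Real.sinh r := by
        rw [← Real.cosh_add_sinh]; field_simp; ring

theorem exists_norm_add_sq_eq {E : Type*} [SeminormedAddCommGroup E] (x y : E) :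
    ∃ g : ℝ, |g| ≤ ‖y‖ ∧ ‖x + y‖ ^ 2 = ‖x‖ ^ 2 + ‖y‖ ^ 2 + 2 * ‖x‖ * g := by
  obtain hx | hx := (norm_nonneg x).eq_or_lt
  · refine ⟨0, by simp, ?_⟩
    have hle := norm_add_le x y
    have hge := norm_sub_le (x + y) x
    rw [add_sub_cancel_left] at hge
    have : ‖x + y‖ = ‖y‖ := by linarith
    rw [this, ← hx]
    ring
  · have hup : ‖x + y‖ ^ 2 ≤ (‖x‖ + ‖y‖) ^ 2 := by gcongr; exact norm_add_le x y
    have hlow : (‖x‖ - ‖y‖) ^ 2 ≤ ‖x + y‖ ^ 2 := by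
      rw [← sq_abs (‖x‖ - ‖y‖)]
      gcongr
      simpa using abs_norm_sub_norm_le x (-y)
    refine ⟨(‖x + y‖ ^ 2 - ‖x‖ ^ 2 - ‖y‖ ^ 2) / (2 * ‖x‖), ?_, by field_simp; ring⟩
    rw [abs_le, le_div_iff₀ (by positivity), div_le_iff₀ (by positivity)]
    constructor <;> linarith

section DualityMap

variable {E : Type*} [NormedAddCommGroup E] [NormedSpace ℝ E]

/-- A selection of the normalized duality mapping: half of a subgradient of `‖·‖ ^ 2` at `x`.
In a `(2, D)`-smooth space it is the only choice, by `norm_dualityMap_sub_le`. -/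
noncomputable def dualityMap (x : E) : StrongDual ℝ E :=
  ‖x‖ • (exists_dual_vector'' ℝ x).choose

theorem dualityMap_apply_self (x : E) : dualityMap x x = ‖x‖ ^ 2 := by
  have := (exists_dual_vector'' ℝ x).choose_spec.2
  simp only [RCLike.ofReal_real_eq_id, id_eq] at this
  rw [dualityMap, smul_apply, this, smul_eq_mul, sq]

theorem norm_dualityMap_le (x : E) : ‖dualityMap x‖ ≤ ‖x‖ := by
  rw [dualityMap, norm_smul, norm_norm]
  exact mul_le_of_le_one_right (norm_nonneg x) (exists_dual_vector'' ℝ x).choose_spec.1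

theorem norm_sq_add_two_mul_dualityMap_le (x y : E) :
    ‖x‖ ^ 2 + 2 * dualityMap x y ≤ ‖x + y‖ ^ 2 := by
  have hdual : ‖x‖ ^ 2 + dualityMap x y ≤ ‖x‖ * ‖x + y‖ := by
    rw [← dualityMap_apply_self, ← map_add]
    exact (le_abs_self _).trans ((dualityMap x).le_of_opNorm_le (norm_dualityMap_le x) _)
  nlinarith [sq_nonneg (‖x + y‖ - ‖x‖)]

variable {D : ℝ}

theorem IsTwoSmooth.one_le_sq {F : Type*} [NormedAddCommGroup F] (hD : IsTwoSmooth F D)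
    {y : F} (hy : y ≠ 0) : 1 ≤ D ^ 2 := by
  have hsmooth := hD.2 0 y
  simp only [zero_add, zero_sub, norm_neg, norm_zero] at hsmooth
  have : 0 < ‖y‖ ^ 2 := by positivity
  nlinarith

theorem IsTwoSmooth.norm_add_sq_le_halve (hD : IsTwoSmooth E D) {x : E} {f : StrongDual ℝ E}
    {κ : ℝ} (h : ∀ y, ‖x + y‖ ^ 2 ≤ ‖x‖ ^ 2 + 2 * f y + (D ^ 2 + κ) * ‖y‖ ^ 2) (y : E) :
    ‖x + y‖ ^ 2 ≤ ‖x‖ ^ 2 + 2 * f y + (D ^ 2 + κ / 2) * ‖y‖ ^ 2 := by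
  have hhalf := h ((1 / 2 : ℝ) • y)
  have hsmooth := hD.2 (x + (1 / 2 : ℝ) • y) ((1 / 2 : ℝ) • y)
  rw [add_assoc, ← add_smul, add_halves, one_smul, add_sub_cancel_right] at hsmooth
  rw [map_smul, smul_eq_mul] at hhalf
  rw [norm_smul, Real.norm_of_nonneg (by norm_num)] at hhalf hsmooth
  linarith

theorem IsTwoSmooth.norm_add_sq_le (hD : IsTwoSmooth E D) (x y : E) :
    ‖x + y‖ ^ 2 ≤ ‖x‖ ^ 2 + 2 * dualityMap x y + D ^ 2 * ‖y‖ ^ 2 := by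
  have hiter (n : ℕ) : ∀ y, ‖x + y‖ ^ 2 ≤
      ‖x‖ ^ 2 + 2 * dualityMap x y + (D ^ 2 + D ^ 2 * (1 / 2) ^ n) * ‖y‖ ^ 2 := by
    induction n with
    | zero =>
      intro y
      have hsub := norm_sq_add_two_mul_dualityMap_le x (-y)
      rw [map_neg, ← sub_eq_add_neg] at hsub
      linarith [hD.2 x y]
    | succ n ih =>
      intro y
      convert hD.norm_add_sq_le_halve ih y using 3
      ring
  have hlim := (((((tendsto_pow_atTop_nhds_zero_of_lt_one (r := (1 / 2 : ℝ)) (by norm_num)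
    (by norm_num)).const_mul (D ^ 2)).const_add (D ^ 2)).mul_const (‖y‖ ^ 2)).const_add
      (‖x‖ ^ 2 + 2 * dualityMap x y))
  rw [mul_zero, add_zero] at hlim
  exact ge_of_tendsto' hlim fun n => hiter n y

theorem IsTwoSmooth.two_mul_dualityMap_sub_apply_le (hD : IsTwoSmooth E D) (x y h : E) :
    2 * (dualityMap y - dualityMap x) h ≤ D ^ 2 * ‖y - x + h‖ ^ 2 := by
  have hup := hD.norm_add_sq_le x (y - x + h)
  have hlow := norm_sq_add_two_mul_dualityMap_le x (y - x)
  rw [← add_assoc, add_sub_cancel, map_add] at hup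
  rw [add_sub_cancel] at hlow
  rw [sub_apply]
  linarith [norm_sq_add_two_mul_dualityMap_le y h]

theorem IsTwoSmooth.norm_dualityMap_sub_le (hD : IsTwoSmooth E D) (x y : E) :
    ‖dualityMap y - dualityMap x‖ ≤ 2 * D ^ 2 * ‖y - x‖ := by
  obtain rfl | hxy := eq_or_ne y x
  · simp
  have hpos : 0 < ‖y - x‖ := norm_pos_iff.2 (sub_ne_zero.2 hxy)
  have hunit (z : E) (hz : ‖z‖ = 1) :
      (dualityMap y - dualityMap x) z ≤ 2 * D ^ 2 * ‖y - x‖ := by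
    have hbound : ‖y - x + ‖y - x‖ • z‖ ≤ 2 * ‖y - x‖ := by
      refine (norm_add_le _ _).trans_eq ?_
      rw [norm_smul, norm_norm, hz]
      ring
    have happly := hD.two_mul_dualityMap_sub_apply_le x y (‖y - x‖ • z)
    rw [map_smul, smul_eq_mul] at happly
    have : D ^ 2 * ‖y - x + ‖y - x‖ • z‖ ^ 2 ≤ D ^ 2 * (2 * ‖y - x‖) ^ 2 := by gcongr
    nlinarith
  refine ContinuousLinearMap.opNorm_le_of_unit_norm (by positivity) fun z hz => abs_le.2 ⟨?_, ?_⟩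
  · rw [neg_le, ← map_neg]
    exact hunit (-z) (by rwa [norm_neg])
  · exact hunit z hz

theorem IsTwoSmooth.continuous_dualityMap (hD : IsTwoSmooth E D) :
    Continuous (dualityMap : E → StrongDual ℝ E) := by
  refine (LipschitzWith.of_dist_le' (K := 2 * D ^ 2) fun x y => ?_).continuous
  rw [dist_eq_norm, dist_eq_norm]
  exact hD.norm_dualityMap_sub_le y x

/-- The gradient of `cosh ‖·‖` at `x`, in a `(2, D)`-smooth space. At `x = 0` the quotient is
`0 / 0 = 0`, which is harmless since `dualityMap 0 = 0`. -/
noncomputable def coshNormGradient (x : E) : StrongDual ℝ E :=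
  (Real.sinh ‖x‖ / ‖x‖) • dualityMap x

theorem norm_coshNormGradient_le (x : E) : ‖coshNormGradient x‖ ≤ Real.sinh ‖x‖ := by
  have hquot : 0 ≤ Real.sinh ‖x‖ / ‖x‖ :=
    div_nonneg (Real.sinh_nonneg_iff.2 (norm_nonneg x)) (norm_nonneg x)
  calc ‖coshNormGradient x‖
      = Real.sinh ‖x‖ / ‖x‖ * ‖dualityMap x‖ := by
        rw [coshNormGradient, norm_smul, Real.norm_of_nonneg hquot]
    _ ≤ Real.sinh ‖x‖ / ‖x‖ * ‖x‖ := mul_le_mul_of_nonneg_left (norm_dualityMap_le x) hquot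
    _ = Real.sinh ‖x‖ := div_mul_cancel_of_imp fun hx => by rw [hx, Real.sinh_zero]

theorem IsTwoSmooth.stronglyMeasurable_coshNormGradient {Ω : Type*} {mΩ : MeasurableSpace Ω}
    (hD : IsTwoSmooth E D) {M : Ω → E} (hM : StronglyMeasurable M) :
    StronglyMeasurable fun ω => coshNormGradient (M ω) := by
  have hnorm := hM.norm.measurable
  exact ((Real.measurable_sinh.comp hnorm).div hnorm).stronglyMeasurable.smul
    (hD.continuous_dualityMap.comp_stronglyMeasurable hM)

theorem IsTwoSmooth.cosh_norm_add_le (hD : IsTwoSmooth E D) (x y : E) :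
    Real.cosh ‖x + y‖ ≤ Real.cosh ‖x‖ * (1 + D ^ 2 * (Real.exp ‖y‖ - 1 - ‖y‖))
      + coshNormGradient x y := by
  obtain rfl | hy := eq_or_ne y 0
  · simp
  obtain ⟨g, hg, hgeq⟩ := exists_norm_add_sq_eq x y
  have hD1 : 0 ≤ D ^ 2 - 1 := sub_nonneg.2 (hD.one_le_sq hy)
  have hexp := exp_sub_one_sub_id_nonneg ‖y‖
  have hslope : ‖x‖ * (dualityMap x y / ‖x‖) = dualityMap x y := by
    refine mul_div_cancel_of_imp' fun hx => ?_
    have := norm_dualityMap_le x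
    rw [hx, norm_le_zero_iff] at this
    rw [this, zero_apply]
  have hcorrection : (g - dualityMap x y / ‖x‖) * Real.sinh ‖x‖
      ≤ Real.cosh ‖x‖ * ((D ^ 2 - 1) * (Real.exp ‖y‖ - 1 - ‖y‖)) := by
    refine mul_sinh_le_cosh_mul (norm_nonneg x) (by positivity) ?_
    have hsq := mul_le_mul_of_nonneg_left
      (sq_div_two_le_exp_sub_one_sub_id (norm_nonneg y)) hD1
    rw [mul_sub, hslope]
    linarith [hD.norm_add_sq_le x y]
  have hinner := cosh_le_of_sq_eq (norm_nonneg x) (norm_pos_iff.2 hy) hg hgeq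
  rw [coshNormGradient, smul_apply, smul_eq_mul, div_mul_comm]
  linarith

/-- The rate in Pinelis' exponential supermartingale for increments of norm at most `a`: the
factor of the conditional variance in the growth of the conditional mean of `cosh ‖·‖`. -/
noncomputable def pinelisRate (D a : ℝ) : ℝ :=
  D ^ 2 * ((Real.exp a - 1 - a) / a ^ 2)

theorem pinelisRate_nonneg (D a : ℝ) : 0 ≤ pinelisRate D a :=
  mul_nonneg (sq_nonneg D) (div_nonneg (exp_sub_one_sub_id_nonneg a) (sq_nonneg a))

theorem IsTwoSmooth.cosh_norm_add_le_of_norm_le (hD : IsTwoSmooth E D) {a : ℝ} (ha : 0 < a)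
    (x : E) {y : E} (hy : ‖y‖ ≤ a) :
    Real.cosh ‖x + y‖ ≤
      Real.cosh ‖x‖ * (1 + pinelisRate D a * ‖y‖ ^ 2) + coshNormGradient x y := by
  calc Real.cosh ‖x + y‖
      ≤ Real.cosh ‖x‖ * (1 + D ^ 2 * (Real.exp ‖y‖ - 1 - ‖y‖)) + coshNormGradient x y :=
        hD.cosh_norm_add_le x y
    _ ≤ Real.cosh ‖x‖ * (1 + D ^ 2 * (‖y‖ ^ 2 * ((Real.exp a - 1 - a) / a ^ 2)))
        + coshNormGradient x y := by
        gcongr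
        exact exp_sub_one_sub_id_le_sq_mul (norm_nonneg y) hy ha
    _ = Real.cosh ‖x‖ * (1 + pinelisRate D a * ‖y‖ ^ 2) + coshNormGradient x y := by
        rw [pinelisRate]; ring

end DualityMap

theorem ae_norm_cosh_norm_le {Ω E : Type*} [NormedAddCommGroup E] [MeasurableSpace Ω]
    {μ : Measure Ω} {X : Ω → E} {b : ℝ} (hb : ∀ᵐ ω ∂μ, ‖X ω‖ ≤ b) :
    ∀ᵐ ω ∂μ, ‖Real.cosh ‖X ω‖‖ ≤ Real.cosh b := by
  filter_upwards [hb] with ω hω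
  rw [Real.norm_of_nonneg (Real.cosh_pos _).le, Real.cosh_le_cosh, abs_norm]
  exact hω.trans (le_abs_self b)

theorem integrable_cosh_norm {Ω E : Type*} [NormedAddCommGroup E] [MeasurableSpace Ω]
    {μ : Measure Ω} [IsFiniteMeasure μ] {X : Ω → E} {b : ℝ} (hX : AEStronglyMeasurable X μ)
    (hb : ∀ᵐ ω ∂μ, ‖X ω‖ ≤ b) : Integrable (fun ω => Real.cosh ‖X ω‖) μ :=
  Integrable.of_bound (Real.continuous_cosh.comp_aestronglyMeasurable hX.norm) _
    (ae_norm_cosh_norm_le hb)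

theorem condExp_mul_one_add_const_mul {Ω : Type*} {m mΩ : MeasurableSpace Ω} {μ : Measure Ω}
    [IsFiniteMeasure μ] (hm : m ≤ mΩ) {A g : Ω → ℝ} {b : ℝ} (hA : StronglyMeasurable[m] A)
    (hAb : ∀ᵐ ω ∂μ, ‖A ω‖ ≤ b) (hg : Integrable g μ) (κ : ℝ) :
    μ[fun ω => A ω * (1 + κ * g ω) | m] =ᵐ[μ] fun ω => A ω * (1 + κ * (μ[g | m]) ω) := by
  have haffine : Integrable (fun ω => 1 + κ * g ω) μ := (integrable_const 1).add (hg.const_mul κ)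
  filter_upwards [condExp_mul_of_stronglyMeasurable_left hA
      (haffine.bdd_mul (hA.mono hm).aestronglyMeasurable hAb) haffine,
    condExp_add (integrable_const (1 : ℝ)) (hg.const_mul κ) m,
    condExp_smul (μ := μ) κ g m] with ω hpull hadd hsmul
  rw [condExp_const hm, Pi.add_apply] at hadd
  refine hpull.trans ?_
  rw [Pi.mul_apply]
  congr 1
  exact hadd.trans (congrArg (1 + ·) hsmul)

section ConditionalStep

variable {E : Type*} [NormedAddCommGroup E] [NormedSpace ℝ E] [CompleteSpace E]
  {Ω : Type*} {m mΩ : MeasurableSpace Ω} {μ : Measure Ω} [IsFiniteMeasure μ]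

theorem condExp_apply_eq_zero (hm : m ≤ mΩ) {L : Ω → StrongDual ℝ E} {d : Ω → E} {b : ℝ}
    (hL : StronglyMeasurable[m] L) (hLb : ∀ᵐ ω ∂μ, ‖L ω‖ ≤ b) (hd : Integrable d μ)
    (hd0 : μ[d | m] =ᵐ[μ] 0) : μ[fun ω => L ω (d ω) | m] =ᵐ[μ] 0 := by
  filter_upwards [condExp_stronglyMeasurable_bilin_of_bound
    (ContinuousLinearMap.id ℝ (StrongDual ℝ E)) hm hL hd b hLb, hd0] with ω hpull hω
  simpa only [ContinuousLinearMap.id_apply, hω, Pi.zero_apply, map_zero] using hpull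

theorem IsTwoSmooth.condExp_cosh_norm_add_le {D : ℝ} (hD : IsTwoSmooth E D) (hm : m ≤ mΩ)
    {M d : Ω → E} {a b : ℝ} (ha : 0 < a) (hM : StronglyMeasurable[m] M)
    (hMb : ∀ᵐ ω ∂μ, ‖M ω‖ ≤ b) (hd : AEStronglyMeasurable d μ) (hda : ∀ᵐ ω ∂μ, ‖d ω‖ ≤ a)
    (hd0 : μ[d | m] =ᵐ[μ] 0) :
    μ[fun ω => Real.cosh ‖M ω + d ω‖ | m] ≤ᵐ[μ] fun ω =>
      Real.cosh ‖M ω‖ * Real.exp (pinelisRate D a * (μ[fun ω => ‖d ω‖ ^ 2 | m]) ω) := by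
  have hdint : Integrable d μ := Integrable.of_bound hd a hda
  have hsq : Integrable (fun ω => ‖d ω‖ ^ 2) μ :=
    (MemLp.of_bound (p := 2) hd a hda).integrable_norm_pow two_ne_zero
  have hcosh : StronglyMeasurable[m] fun ω => Real.cosh ‖M ω‖ :=
    Real.continuous_cosh.comp_stronglyMeasurable hM.norm
  have hquad : Integrable
      (fun ω => Real.cosh ‖M ω‖ * (1 + pinelisRate D a * ‖d ω‖ ^ 2)) μ :=
    ((integrable_const 1).add (hsq.const_mul _)).bdd_mul (hcosh.mono hm).aestronglyMeasurable
      (ae_norm_cosh_norm_le hMb)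
  have hgradm := hD.stronglyMeasurable_coshNormGradient hM
  have hgradb : ∀ᵐ ω ∂μ, ‖coshNormGradient (M ω)‖ ≤ Real.sinh b := by
    filter_upwards [hMb] with ω hω
    exact (norm_coshNormGradient_le _).trans (Real.sinh_le_sinh.2 hω)
  have hgrad : Integrable (fun ω => coshNormGradient (M ω) (d ω)) μ :=
    (ContinuousLinearMap.id ℝ (StrongDual ℝ E)).integrable_of_bilin_of_bdd_left _
      (hgradm.mono hm).aestronglyMeasurable hgradb hdint
  have hleft : Integrable (fun ω => Real.cosh ‖M ω + d ω‖) μ :=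
    integrable_cosh_norm (b := b + a) ((hM.mono hm).aestronglyMeasurable.add hd) <| by
      filter_upwards [hMb, hda] with ω hω hω' using norm_add_le_of_le hω hω'
  have hpointwise := hda.mono fun ω hω => hD.cosh_norm_add_le_of_norm_le ha (M ω) hω
  filter_upwards [condExp_mono hleft (hquad.add hgrad) hpointwise, condExp_add hquad hgrad m,
    condExp_mul_one_add_const_mul hm hcosh (ae_norm_cosh_norm_le hMb) hsq (pinelisRate D a),
    condExp_apply_eq_zero hm hgradm hgradb hdint hd0] with ω hle hadd hpull hzero
  rw [hadd, Pi.add_apply, hpull, hzero, Pi.zero_apply, add_zero] at hle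
  refine hle.trans (mul_le_mul_of_nonneg_left ?_ (Real.cosh_pos _).le)
  rw [add_comm]
  exact Real.add_one_le_exp _

end ConditionalStep

section Martingale

variable {E : Type*} [NormedAddCommGroup E]
  {Ω : Type*} {mΩ : MeasurableSpace Ω} {μ : Measure Ω} {F : Filtration ℕ mΩ} {M : ℕ → Ω → E}

/-- The predictable variation of a vector-valued process: the sum of the conditional second
moments of the norms of its first `n` increments. -/
noncomputable def predictableVariation (μ : Measure Ω) (F : Filtration ℕ mΩ) (M : ℕ → Ω → E)
    (n : ℕ) (ω : Ω) : ℝ :=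
  ∑ k ∈ Finset.range n, (μ[fun ω => ‖M (k + 1) ω - M k ω‖ ^ 2 | F k]) ω

theorem predictableVariation_nonneg (n : ℕ) :
    ∀ᵐ ω ∂μ, 0 ≤ predictableVariation μ F M n ω := by
  have hterm : ∀ᵐ ω ∂μ, ∀ k, 0 ≤ (μ[fun ω => ‖M (k + 1) ω - M k ω‖ ^ 2 | F k]) ω :=
    ae_all_iff.2 fun k => condExp_nonneg (ae_of_all _ fun ω => sq_nonneg _)
  filter_upwards [hterm] with ω hω using Finset.sum_nonneg fun k _ => hω k

theorem stronglyMeasurable_predictableVariation_succ (n : ℕ) :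
    StronglyMeasurable[F n] (predictableVariation μ F M (n + 1)) :=
  Finset.stronglyMeasurable_fun_sum _ fun _ hk =>
    stronglyMeasurable_condExp.mono (F.mono (Nat.lt_succ_iff.1 (Finset.mem_range.1 hk)))

theorem stronglyAdapted_predictableVariation :
    StronglyAdapted F (predictableVariation μ F M) := fun _ =>
  Finset.stronglyMeasurable_fun_sum _ fun _ hk =>
    stronglyMeasurable_condExp.mono (F.mono (Finset.mem_range.1 hk).le)

theorem ae_norm_le_of_norm_sub_le {a : ℝ} (hM0 : M 0 = 0)
    (ha : ∀ k, ∀ᵐ ω ∂μ, ‖M (k + 1) ω - M k ω‖ ≤ a) (n : ℕ) : ∀ᵐ ω ∂μ, ‖M n ω‖ ≤ n * a := by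
  induction n with
  | zero => simp [hM0]
  | succ n ih =>
    filter_upwards [ih, ha n] with ω hprev hstep
    rw [Nat.cast_succ, add_one_mul]
    simpa using norm_add_le_of_le hprev hstep

theorem predictableVariation_le [IsFiniteMeasure μ] {a : ℝ}
    (hM : ∀ n, AEStronglyMeasurable (M n) μ)
    (ha : ∀ k, ∀ᵐ ω ∂μ, ‖M (k + 1) ω - M k ω‖ ≤ a) (n : ℕ) :
    ∀ᵐ ω ∂μ, predictableVariation μ F M n ω ≤ n * a ^ 2 := by
  have hterm : ∀ᵐ ω ∂μ, ∀ k, (μ[fun ω => ‖M (k + 1) ω - M k ω‖ ^ 2 | F k]) ω ≤ a ^ 2 := by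
    refine ae_all_iff.2 fun k => ?_
    have hsq : Integrable (fun ω => ‖M (k + 1) ω - M k ω‖ ^ 2) μ :=
      (MemLp.of_bound (p := 2) ((hM (k + 1)).sub (hM k)) a (ha k)).integrable_norm_pow two_ne_zero
    have hmono := condExp_mono (m := F k) hsq (integrable_const (a ^ 2))
      ((ha k).mono fun ω hω => pow_le_pow_left₀ (norm_nonneg _) hω 2)
    rwa [condExp_const (F.le k)] at hmono
  filter_upwards [hterm] with ω hω
  simpa [predictableVariation] using
    Finset.sum_le_card_nsmul (Finset.range n) _ _ fun k _ => hω k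

variable [NormedSpace ℝ E]

theorem predictableVariation_smul (s : ℝ) (n : ℕ) :
    predictableVariation μ F (s • M) n =ᵐ[μ] s ^ 2 • predictableVariation μ F M n := by
  have hscale (k : ℕ) : (fun ω => ‖s • M (k + 1) ω - s • M k ω‖ ^ 2)
      = s ^ 2 • fun ω => ‖M (k + 1) ω - M k ω‖ ^ 2 := by
    funext ω
    simp only [Pi.smul_apply, ← smul_sub, norm_smul, mul_pow, Real.norm_eq_abs, sq_abs,
      smul_eq_mul]
  have hterm : ∀ᵐ ω ∂μ, ∀ k, (μ[s ^ 2 • fun ω => ‖M (k + 1) ω - M k ω‖ ^ 2 | F k]) ω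
      = s ^ 2 * (μ[fun ω => ‖M (k + 1) ω - M k ω‖ ^ 2 | F k]) ω :=
    ae_all_iff.2 fun k => condExp_smul (s ^ 2) _ (F k)
  filter_upwards [hterm] with ω hω
  simp only [predictableVariation, Pi.smul_apply, hscale, hω, smul_eq_mul, Finset.mul_sum]

variable [CompleteSpace E]

theorem condExp_martingale_increment_eq_zero (hM : Martingale M F μ) (n : ℕ) :
    μ[fun ω => M (n + 1) ω - M n ω | F n] =ᵐ[μ] 0 := by
  filter_upwards [condExp_sub (hM.integrable (n + 1)) (hM.integrable n) (F n),
    hM.condExp_ae_eq n.le_succ, hM.condExp_ae_eq le_rfl] with ω hsub hnext hself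
  rw [Pi.sub_apply, hnext, hself, sub_self] at hsub
  exact hsub

theorem IsTwoSmooth.supermartingale_cosh_mul_exp [IsFiniteMeasure μ] {D a : ℝ}
    (hD : IsTwoSmooth E D) (hM : Martingale M F μ) (hM0 : M 0 = 0) (ha : 0 < a)
    (hMa : ∀ k, ∀ᵐ ω ∂μ, ‖M (k + 1) ω - M k ω‖ ≤ a) :
    Supermartingale (fun n ω => Real.cosh ‖M n ω‖ *
      Real.exp (-(pinelisRate D a * predictableVariation μ F M n ω))) F μ := by
  have hbound := ae_norm_le_of_norm_sub_le hM0 hMa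
  have hadapted := stronglyAdapted_predictableVariation (μ := μ) (F := F) (M := M)
  have hcosh (n : ℕ) : Integrable (fun ω => Real.cosh ‖M n ω‖) μ :=
    integrable_cosh_norm (hM.integrable n).aestronglyMeasurable (hbound n)
  have hexp {m : MeasurableSpace Ω} {V : Ω → ℝ} (hV : StronglyMeasurable[m] V) :
      StronglyMeasurable[m] fun ω => Real.exp (-(pinelisRate D a * V ω)) :=
    Real.continuous_exp.comp_stronglyMeasurable (hV.const_mul _).neg
  have hint (n k : ℕ) : Integrable (fun ω => Real.cosh ‖M n ω‖ *
      Real.exp (-(pinelisRate D a * predictableVariation μ F M k ω))) μ := by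
    refine (hcosh n).mul_bdd (c := 1) ((hexp (hadapted k)).mono (F.le k)).aestronglyMeasurable ?_
    filter_upwards [predictableVariation_nonneg (μ := μ) (F := F) (M := M) k] with ω hω
    rw [Real.norm_of_nonneg (Real.exp_pos _).le, Real.exp_le_one_iff, neg_nonpos]
    exact mul_nonneg (pinelisRate_nonneg D a) hω
  refine supermartingale_nat (fun n => ?_) (fun n => hint n n) fun n => ?_
  · exact (Real.continuous_cosh.comp_stronglyMeasurable (hM.stronglyMeasurable n).norm).mul
      (hexp (hadapted n))
  have hstep := hD.condExp_cosh_norm_add_le (F.le n) ha (hM.stronglyMeasurable n) (hbound n)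
    ((hM.integrable (n + 1)).sub (hM.integrable n)).aestronglyMeasurable (hMa n)
    (condExp_martingale_increment_eq_zero hM n)
  simp only [Pi.sub_apply, add_sub_cancel] at hstep
  filter_upwards [condExp_mul_of_stronglyMeasurable_right
    (hexp (stronglyMeasurable_predictableVariation_succ n)) (hint (n + 1) (n + 1))
    (hcosh (n + 1)), hstep] with ω hpull hω
  refine hpull.le.trans ((mul_le_mul_of_nonneg_right hω (Real.exp_pos _).le).trans_eq ?_)
  rw [mul_assoc, ← Real.exp_add, predictableVariation, predictableVariation,
    Finset.sum_range_succ]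
  ring_nf

theorem IsTwoSmooth.measureReal_norm_ge_le_exp [IsProbabilityMeasure μ] {D a B r : ℝ}
    (hD : IsTwoSmooth E D) (hM : Martingale M F μ) (hM0 : M 0 = 0) (ha : 0 < a)
    (hMa : ∀ k, ∀ᵐ ω ∂μ, ‖M (k + 1) ω - M k ω‖ ≤ a) {n : ℕ}
    (hB : ∀ᵐ ω ∂μ, predictableVariation μ F M n ω ≤ B) (hr : 0 ≤ r) :
    μ.real {ω | r ≤ ‖M n ω‖} ≤ 2 * Real.exp (-(r - pinelisRate D a * B)) := by
  set Z : ℕ → Ω → ℝ := fun n ω => Real.cosh ‖M n ω‖ *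
    Real.exp (-(pinelisRate D a * predictableVariation μ F M n ω)) with hZ
  have hsuper : Supermartingale Z F μ := hD.supermartingale_cosh_mul_exp hM hM0 ha hMa
  have hmean : ∫ ω, Z n ω ∂μ ≤ 1 := by
    simpa [hZ, hM0, predictableVariation] using
      hsuper.setIntegral_le n.zero_le MeasurableSet.univ
  set t : ℝ := Real.exp (r - pinelisRate D a * B) / 2 with ht
  have hsubset : {ω | r ≤ ‖M n ω‖} ≤ᵐ[μ] {ω | t ≤ Z n ω} := by
    filter_upwards [hB] with ω hω (hle : r ≤ ‖M n ω‖)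
    have hcosh : Real.exp r / 2 ≤ Real.cosh ‖M n ω‖ := by
      have hmono := Real.cosh_le_cosh.2 (abs_le_abs_of_nonneg hr hle)
      rw [Real.cosh_eq r] at hmono
      linarith [Real.exp_pos (-r)]
    have hrate := pinelisRate_nonneg D a
    calc t = Real.exp r / 2 * Real.exp (-(pinelisRate D a * B)) := by
          rw [ht, sub_eq_add_neg, Real.exp_add]; ring
      _ ≤ Z n ω := by simp only [hZ]; gcongr
  have hmarkov : t * μ.real {ω | r ≤ ‖M n ω‖} ≤ 1 := calc
    _ ≤ t * μ.real {ω | t ≤ Z n ω} := mul_le_mul_of_nonneg_left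
        (ENNReal.toReal_mono (measure_ne_top _ _) (measure_mono_ae hsubset)) (by positivity)
    _ ≤ ∫ ω, Z n ω ∂μ := mul_meas_ge_le_integral_of_nonneg
        (ae_of_all _ fun ω => (mul_pos (Real.cosh_pos _) (Real.exp_pos _)).le)
        (hsuper.integrable n) t
    _ ≤ 1 := hmean
  rw [Real.exp_neg, ← div_eq_mul_inv, le_div_iff₀ (Real.exp_pos _), mul_comm]
  rwa [ht, div_mul_eq_mul_div, div_le_one two_pos] at hmarkov

theorem IsTwoSmooth.measureReal_norm_ge_le_exp_smul [IsProbabilityMeasure μ] {D a B r s : ℝ}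
    (hD : IsTwoSmooth E D) (hM : Martingale M F μ) (hM0 : M 0 = 0) (ha : 0 < a)
    (hMa : ∀ k, ∀ᵐ ω ∂μ, ‖M (k + 1) ω - M k ω‖ ≤ a) {n : ℕ}
    (hB : ∀ᵐ ω ∂μ, predictableVariation μ F M n ω ≤ B) (hr : 0 ≤ r) (hs : 0 < s) :
    μ.real {ω | r ≤ ‖M n ω‖} ≤
      2 * Real.exp (-(s * r - D ^ 2 * B * ((Real.exp (s * a) - 1 - s * a) / a ^ 2))) := by
  have hevent : {ω | r ≤ ‖M n ω‖} = {ω | s * r ≤ ‖(s • M) n ω‖} := by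
    ext ω
    simp only [Set.mem_ofPred_eq, Pi.smul_apply, norm_smul, Real.norm_of_nonneg hs.le]
    exact (mul_le_mul_iff_right₀ hs).symm
  have hrate : D ^ 2 * B * ((Real.exp (s * a) - 1 - s * a) / a ^ 2)
      = pinelisRate D (s * a) * (s ^ 2 * B) := by
    rw [pinelisRate]; field_simp
  rw [hevent, hrate]
  refine hD.measureReal_norm_ge_le_exp (Martingale.smul s hM)
    (by rw [Pi.smul_apply, hM0, smul_zero]) (by positivity) (fun k => ?_) ?_ (by positivity)
  · filter_upwards [hMa k] with ω hω
    simp only [Pi.smul_apply, ← smul_sub, norm_smul, Real.norm_of_nonneg hs.le]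
    gcongr
  · filter_upwards [predictableVariation_smul (F := F) (M := M) s n, hB] with ω hsmul hω
    rw [hsmul, Pi.smul_apply, smul_eq_mul]
    gcongr

theorem IsTwoSmooth.measureReal_norm_ge_le_bernstein [IsProbabilityMeasure μ] {D a B c r : ℝ}
    (hD : IsTwoSmooth E D) (hM : Martingale M F μ) (hM0 : M 0 = 0) (ha : 0 < a)
    (hMa : ∀ k, ∀ᵐ ω ∂μ, ‖M (k + 1) ω - M k ω‖ ≤ a) {n : ℕ}
    (hB : ∀ᵐ ω ∂μ, predictableVariation μ F M n ω ≤ B) (hr : 0 < r)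
    (hc : 1 / 2 ≤ c) (hc1 : c ≤ 1) :
    μ.real {ω | r ≤ ‖M n ω‖} ≤
      2 * Real.exp (-(r ^ 2 / (2 * (D ^ 2 * B / c + c * a * r / 3)))) := by
  obtain ⟨ω, hnonneg, hle⟩ := ((predictableVariation_nonneg (F := F) (M := M) n).and hB).exists
  obtain ⟨s, hs, hrate⟩ := exists_scaled_bernstein_rate_le ha
    (mul_nonneg (sq_nonneg D) (hnonneg.trans hle)) hr hc hc1
  refine (hD.measureReal_norm_ge_le_exp_smul hM hM0 ha hMa hB hr.le hs).trans ?_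
  gcongr

end Martingale

section Tuples

variable {E : Type*} [NormedAddCommGroup E] {N m : ℕ}

/-- The sum of the vectors whose labels are among the first `j` entries of the tuple `a`. -/
def drawnSum (v : Fin N → E) (a : Fin m → Fin N) (j : ℕ) : E :=
  ∑ i : Fin m with i.val < j, v (a i)

theorem drawnSum_zero (v : Fin N → E) (a : Fin m → Fin N) : drawnSum v a 0 = 0 := by
  simp [drawnSum]

theorem drawnSum_succ (v : Fin N → E) (a : Fin m → Fin N) (k : Fin m) :
    drawnSum v a (k + 1) = v (a k) + drawnSum v a k := by
  have hfilter : Finset.univ.filter (fun i : Fin m => i.val < k + 1)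
      = insert k (Finset.univ.filter fun i : Fin m => i.val < k) := by
    ext i
    simp only [Finset.mem_filter, Finset.mem_univ, true_and, Finset.mem_insert, Fin.ext_iff]
    lia
  rw [drawnSum, hfilter, Finset.sum_insert (by simp), drawnSum]

theorem drawnSum_length (v : Fin N → E) (a : Fin m → Fin N) :
    drawnSum v a m = ∑ i, v (a i) := by
  simp [drawnSum]

/-- The labels that do not occur among the entries of the injective tuple `a` before the `k`-th
one. -/
def remainingLabels (a : Fin m ↪ Fin N) (k : Fin m) : Finset (Fin N) :=
  ((Finset.Iio k).map a)ᶜ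

theorem mem_remainingLabels {a : Fin m ↪ Fin N} {k : Fin m} {j : Fin N} :
    j ∈ remainingLabels a k ↔ ∀ i < k, a i ≠ j := by
  simp [remainingLabels]

theorem apply_mem_remainingLabels (a : Fin m ↪ Fin N) (k : Fin m) :
    a k ∈ remainingLabels a k :=
  mem_remainingLabels.2 fun _ hi h => hi.ne (a.injective h)

theorem sum_remainingLabels (v : Fin N → E) (a : Fin m ↪ Fin N) (k : Fin m) :
    ∑ j ∈ remainingLabels a k, v j = ∑ i, v i - drawnSum v a k := by
  have hdrawn : ∑ j ∈ (Finset.Iio k).map a, v j = drawnSum v a k := by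
    rw [Finset.sum_map, drawnSum]
    congr 1
    ext i
    simp
  rw [eq_sub_iff_add_eq, ← hdrawn, remainingLabels, Finset.sum_compl_add_sum]

theorem card_remainingLabels (a : Fin m ↪ Fin N) (k : Fin m) :
    ((remainingLabels a k).card : ℝ) = N - k := by
  have hcard := Finset.card_compl_add_card ((Finset.Iio k).map a)
  rw [Finset.card_map, Fin.card_Iio, Fintype.card_fin] at hcard
  rw [eq_sub_iff_add_eq]
  exact_mod_cast hcard

variable [NormedSpace ℝ E]

/-- The mean of the vectors that remain after the first `j` entries of the tuple `a` have been
drawn, for injective `a` and `j ≤ m`. -/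
noncomputable def remainingMean (v : Fin N → E) (a : Fin m → Fin N) (j : ℕ) : E :=
  (1 / ((N : ℝ) - j)) • (∑ i, v i - drawnSum v a j)

theorem remainingMean_sub_succ (v : Fin N → E) (a : Fin m → Fin N) {k : Fin m}
    (hk : (k : ℕ) + 1 < N) :
    remainingMean v a k - remainingMean v a (k + 1)
      = (1 / ((N : ℝ) - (k + 1))) • (v (a k) - remainingMean v a k) := by
  have hk' : (k : ℝ) + 1 < N := by exact_mod_cast hk
  have hnow : (N : ℝ) - k ≠ 0 := by linarith
  have hnext : (N : ℝ) - (k + 1) ≠ 0 := by linarith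
  rw [remainingMean, remainingMean, drawnSum_succ]
  push_cast
  match_scalars <;> field_simp <;> ring

theorem remainingMean_zero_sub_length (v : Fin N → E) (a : Fin m → Fin N) (hm : 0 < m)
    (hmN : m < N) :
    remainingMean v a 0 - remainingMean v a m
      = ((m : ℝ) / (N - m)) • ((1 / (m : ℝ)) • ∑ i, v (a i) - (1 / (N : ℝ)) • ∑ i, v i) := by
  have hm' : (0 : ℝ) < m := by exact_mod_cast hm
  have hmN' : (m : ℝ) < N := by exact_mod_cast hmN
  have hN : (N : ℝ) ≠ 0 := by linarith
  have hNm : (N : ℝ) - m ≠ 0 := by linarith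
  rw [remainingMean, remainingMean, drawnSum_zero, drawnSum_length]
  push_cast
  match_scalars <;> field_simp
  ring

theorem sub_remainingMean (v : Fin N → E) (a : Fin m ↪ Fin N) (k : Fin m) :
    v (a k) - remainingMean v a k
      = (1 / ((N : ℝ) - k)) • ∑ j ∈ remainingLabels a k, (v (a k) - v j) := by
  have hpos : (N : ℝ) - k ≠ 0 := by
    rw [← card_remainingLabels a k, Nat.cast_ne_zero]
    exact Finset.card_ne_zero_of_mem (apply_mem_remainingLabels a k)
  rw [Finset.sum_sub_distrib, Finset.sum_const, sum_remainingLabels, ← Nat.cast_smul_eq_nsmul ℝ,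
    card_remainingLabels, smul_sub, smul_smul, one_div_mul_cancel hpos, one_smul, remainingMean]

theorem norm_sub_remainingMean_le {v : Fin N → E} {R : ℝ} (hv : ∀ i, ‖v i‖ ≤ R)
    (a : Fin m ↪ Fin N) {k : Fin m} (hk : (k : ℕ) < N) :
    ‖v (a k) - remainingMean v a k‖ ≤ (N - (k + 1)) * (2 * R) / (N - k) := by
  have hk' : (k : ℝ) < N := by exact_mod_cast hk
  have hmem := apply_mem_remainingLabels a k
  have hcard : (((remainingLabels a k).erase (a k)).card : ℝ) = N - (k + 1) := by
    rw [Finset.card_erase_of_mem hmem, Nat.cast_sub (Finset.card_pos.2 ⟨_, hmem⟩),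
      card_remainingLabels, Nat.cast_one, sub_add_eq_sub_sub]
  have hsum : ‖∑ j ∈ remainingLabels a k, (v (a k) - v j)‖ ≤ (N - (k + 1)) * (2 * R) := by
    rw [← Finset.add_sum_erase _ _ hmem, sub_self, zero_add, ← hcard, ← nsmul_eq_mul, two_mul]
    exact (norm_sum_le_of_le _ fun j _ => norm_sub_le_of_le (hv _) (hv _)).trans_eq
      (Finset.sum_const _)
  rw [sub_remainingMean, norm_smul, Real.norm_of_nonneg (one_div_nonneg.2 (by linarith)),
    one_div_mul_eq_div]
  gcongr

theorem norm_remainingMean_sub_succ_le {v : Fin N → E} {R : ℝ} (hv : ∀ i, ‖v i‖ ≤ R)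
    (a : Fin m ↪ Fin N) {k : Fin m} (hk : (k : ℕ) + 1 < N) :
    ‖remainingMean v a k - remainingMean v a (k + 1)‖ ≤ 2 * R / (N - k) := by
  have hk' : (k : ℝ) + 1 < N := by exact_mod_cast hk
  have hnext : (0 : ℝ) < N - (k + 1) := by linarith
  rw [remainingMean_sub_succ v a hk, norm_smul, Real.norm_of_nonneg (one_div_nonneg.2 hnext.le),
    one_div_mul_eq_div, div_le_iff₀ hnext]
  refine (norm_sub_remainingMean_le hv a (by lia)).trans_eq ?_
  ring

theorem setValue_apply_of_lt {a : Fin m ↪ Fin N} {k : Fin m} {j : Fin N}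
    (hj : j ∈ remainingLabels a k) {i : Fin m} (hi : i < k) : a.setValue k j i = a i :=
  Function.Embedding.setValue_eq_of_ne hi.ne (mem_remainingLabels.1 hj i hi)

theorem setValue_setValue_apply_self (a : Fin m ↪ Fin N) (k : Fin m) (j : Fin N) :
    (a.setValue k j).setValue k (a k) = a := by
  ext i
  simp only [Function.Embedding.setValue, Function.Embedding.coeFn_mk]
  grind [a.injective.eq_iff]

theorem sum_sub_remainingMean_eq_zero (v : Fin N → E) (k : Fin m) {T : Set (Fin m → Fin N)}
    [DecidablePred (· ∈ T)] (hT : DependsOn (· ∈ T) (Set.Iio k)) :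
    ∑ a : Fin m ↪ Fin N with DFunLike.coe a ∈ T, (v (a k) - remainingMean v a k) = 0 := by
  simp only [sub_remainingMean, ← Finset.smul_sum]
  rw [Finset.sum_sigma']
  -- Exchanging the `k`-th entry with a remaining label `j` flips the sign of `v (a k) - v j`.
  refine smul_eq_zero_of_right _ <| Finset.sum_involution
    (fun p _ => ⟨p.1.setValue k p.2, p.1 k⟩) (fun _ _ => by simp) ?_ ?_ ?_
  · rintro ⟨a, j⟩ - hne hfix
    obtain rfl : a k = j := congrArg Sigma.snd hfix
    exact hne (sub_self _)
  · rintro ⟨a, j⟩ hp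
    obtain ⟨haT, hj⟩ : ⇑a ∈ T ∧ j ∈ remainingLabels a k := by simpa using hp
    have hpast (i : Fin m) (hi : i < k) : a i = a.setValue k j i :=
      (setValue_apply_of_lt hj hi).symm
    have hremaining : a k ∈ remainingLabels (a.setValue k j) k :=
      mem_remainingLabels.2 fun i hi => by
        rw [← hpast i hi]
        exact mem_remainingLabels.1 (apply_mem_remainingLabels a k) i hi
    simpa [hremaining] using (hT hpast).mp haT
  · rintro ⟨a, j⟩ -
    simp [setValue_setValue_apply_self]

end Tuples

section Law

variable {Ω : Type*} {mΩ : MeasurableSpace Ω} {μ : Measure Ω} {N m : ℕ} {I : Fin m → Ω → Fin N}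

namespace IsSamplingWithoutReplacement

theorem map_singleton (hI : IsSamplingWithoutReplacement μ I) (a : Fin m ↪ Fin N) :
    μ.map (fun ω k => I k ω) {⇑a} = ((N.descFactorial m : ℕ) : ℝ≥0∞)⁻¹ := by
  rw [Measure.map_apply (measurable_pi_iff.2 hI.measurable) (measurableSet_singleton _),
    ← hI.uniform a a.injective]
  congr 1
  ext ω
  exact funext_iff

theorem ae_injective [IsProbabilityMeasure μ] (hI : IsSamplingWithoutReplacement μ I)
    (hmN : m ≤ N) : ∀ᵐ ω ∂μ, Function.Injective fun k => I k ω := by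
  have htuple : Measurable fun ω k => I k ω := measurable_pi_iff.2 hI.measurable
  have := Measure.isProbabilityMeasure_map (μ := μ) htuple.aemeasurable
  let coeEmb : (Fin m ↪ Fin N) ↪ (Fin m → Fin N) := ⟨_, DFunLike.coe_injective⟩
  have hmass : μ.map (fun ω k => I k ω) (Finset.univ.map coeEmb) = 1 := by
    rw [← sum_measure_singleton, Finset.sum_map]
    refine (Finset.sum_congr rfl fun a _ => hI.map_singleton a).trans ?_
    rw [Finset.sum_const, Finset.card_univ, Fintype.card_embedding_eq, Fintype.card_fin,
      Fintype.card_fin, nsmul_eq_mul]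
    exact ENNReal.mul_inv_cancel (Nat.cast_ne_zero.2 (Nat.descFactorial_pos.2 hmN).ne')
      (ENNReal.natCast_ne_top _)
  have hmem := (mem_ae_iff_prob_eq_one (Finset.measurableSet _)).2 hmass
  filter_upwards [ae_of_ae_map htuple.aemeasurable hmem] with ω hω
  obtain ⟨a, -, ha⟩ := Finset.mem_map.1 hω
  exact ha ▸ a.injective

end IsSamplingWithoutReplacement

theorem integrable_comp_tuple {E : Type*} [NormedAddCommGroup E] [IsFiniteMeasure μ]
    (hI : ∀ k, Measurable (I k)) (φ : (Fin m → Fin N) → E) :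
    Integrable (fun ω => φ fun k => I k ω) μ :=
  (Integrable.of_finite (f := φ)).comp_measurable (measurable_pi_iff.2 hI)

theorem IsSamplingWithoutReplacement.integral_comp_tuple {E : Type*} [NormedAddCommGroup E]
    [NormedSpace ℝ E] [CompleteSpace E] [IsProbabilityMeasure μ]
    (hI : IsSamplingWithoutReplacement μ I) (hmN : m ≤ N) (φ : (Fin m → Fin N) → E) :
    ∫ ω, φ (fun k => I k ω) ∂μ = (N.descFactorial m : ℝ)⁻¹ • ∑ a : Fin m ↪ Fin N, φ a := by
  have htuple : Measurable fun ω k => I k ω := measurable_pi_iff.2 hI.measurable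
  have := Measure.isProbabilityMeasure_map (μ := μ) htuple.aemeasurable
  let coeEmb : (Fin m ↪ Fin N) ↪ (Fin m → Fin N) := ⟨_, DFunLike.coe_injective⟩
  have hsupport : ∀ᵐ a ∂μ.map (fun ω k => I k ω), a ∈ (↑(Finset.univ.map coeEmb) : Set _) := by
    refine (ae_map_iff htuple.aemeasurable (Finset.measurableSet _)).2 ?_
    filter_upwards [hI.ae_injective hmN] with ω hω
    exact Finset.mem_map.2 ⟨⟨_, hω⟩, Finset.mem_univ _, rfl⟩
  rw [← integral_map (f := φ) htuple.aemeasurable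
      StronglyMeasurable.of_discrete.aestronglyMeasurable,
    ← Measure.restrict_eq_self_of_ae_mem hsupport, setIntegral_finset _ Integrable.of_finite,
    Finset.sum_map, Finset.smul_sum]
  refine Finset.sum_congr rfl fun a _ => ?_
  have hatom : (μ.map fun ω k => I k ω).real {⇑a} = (N.descFactorial m : ℝ)⁻¹ := by
    rw [measureReal_def, hI.map_singleton a, ENNReal.toReal_inv, ENNReal.toReal_natCast]
  exact congrArg (· • φ a) hatom

/-- The filtration generated by the drawn vectors: at time `j` the first `j` of them are known. -/
def pastFiltration {E : Type*} [NormedAddCommGroup E] (v : Fin N → E)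
    (hI : ∀ k, Measurable (I k)) : Filtration ℕ mΩ where
  seq j := ⨆ i : Fin m, ⨆ _ : (i : ℕ) < j, MeasurableSpace.comap (fun ω => v (I i ω)) (borel E)
  mono' _ _ h := iSup_mono fun _ => iSup_mono' fun hi => ⟨hi.trans_le h, le_rfl⟩
  le' j := by
    refine iSup₂_le fun i _ => ?_
    rintro _ ⟨t, -, rfl⟩
    exact hI i (Set.toFinite (v ⁻¹' t)).measurableSet

section Past

variable {E : Type*} [NormedAddCommGroup E] (v : Fin N → E) (hI : ∀ k, Measurable (I k))

theorem stronglyMeasurable_pastFiltration {i : Fin m} {j : ℕ} (hij : (i : ℕ) < j) :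
    StronglyMeasurable[pastFiltration v hI j] fun ω => v (I i ω) := by
  borelize E
  refine stronglyMeasurable_iff_measurable_separable.2 ⟨fun t ht => ?_, ?_⟩
  · exact le_iSup₂_of_le (f := fun (i : Fin m) (_ : (i : ℕ) < j) =>
      MeasurableSpace.comap (fun ω => v (I i ω)) (borel E)) i hij le_rfl _ ⟨t, ht, rfl⟩
  · exact ((Set.finite_range v).subset (Set.range_comp_subset_range (I i) v)).isSeparable

theorem exists_preimage_of_measurableSet_pastFiltration (k : Fin m) {s : Set Ω}
    (hs : MeasurableSet[pastFiltration v hI k] s) :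
    ∃ T : Set (Fin m → Fin N),
      s = (fun ω k => I k ω) ⁻¹' T ∧ DependsOn (· ∈ T) (Set.Iio k) := by
  have hle : (pastFiltration v hI k : MeasurableSpace Ω) ≤
      MeasurableSpace.comap (fun ω (i : Set.Iio k) => I i ω) ⊤ := by
    refine iSup₂_le fun i hi => ?_
    rintro _ ⟨t, -, rfl⟩
    exact ⟨{h | v (h ⟨i, hi⟩) ∈ t}, trivial, rfl⟩
  obtain ⟨S, -, rfl⟩ := hle s hs
  exact ⟨(Set.Iio k).domRestrict ⁻¹' S, rfl,
    fun _ _ hab => congrArg (· ∈ S) (Set.dependsOn_domRestrict _ hab)⟩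

variable [NormedSpace ℝ E]

theorem stronglyMeasurable_remainingMean (j : ℕ) :
    StronglyMeasurable[pastFiltration v hI j] fun ω => remainingMean v (fun k => I k ω) j :=
  (stronglyMeasurable_const.sub (Finset.stronglyMeasurable_fun_sum _ fun _ hi =>
    stronglyMeasurable_pastFiltration v hI (Finset.mem_filter.1 hi).2)).const_smul _

end Past

variable {E : Type*} [NormedAddCommGroup E] [NormedSpace ℝ E] [CompleteSpace E]
  [IsProbabilityMeasure μ]

theorem IsSamplingWithoutReplacement.setIntegral_sub_remainingMean_eq_zero
    (hI : IsSamplingWithoutReplacement μ I) (hmN : m ≤ N) (v : Fin N → E) (k : Fin m) {s : Set Ω}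
    (hs : MeasurableSet[pastFiltration v hI.measurable k] s) :
    ∫ ω in s, (v (I k ω) - remainingMean v (fun k => I k ω) k) ∂μ = 0 := by
  classical
  have hs' := (pastFiltration v hI.measurable).le k s hs
  obtain ⟨T, rfl, hT⟩ := exists_preimage_of_measurableSet_pastFiltration v hI.measurable k hs
  rw [← integral_indicator hs']
  refine (hI.integral_comp_tuple hmN
    (T.indicator fun a => v (a k) - remainingMean v a k)).trans ?_
  rw [Finset.sum_indicator_eq_sum_filter Finset.univ
      (fun (_ : Fin m ↪ Fin N) (a : Fin m → Fin N) => v (a k) - remainingMean v a k)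
      (fun _ => T) DFunLike.coe,
    sum_sub_remainingMean_eq_zero v k hT, smul_zero]

theorem IsSamplingWithoutReplacement.condExp_eq_remainingMean
    (hI : IsSamplingWithoutReplacement μ I) (hmN : m ≤ N) (v : Fin N → E) (k : Fin m) :
    μ[fun ω => v (I k ω) | pastFiltration v hI.measurable k] =ᵐ[μ]
      fun ω => remainingMean v (fun k => I k ω) k := by
  have hdraw := integrable_comp_tuple (μ := μ) hI.measurable fun a => v (a k)
  have hmean := integrable_comp_tuple (μ := μ) hI.measurable fun a => remainingMean v a k
  refine (ae_eq_condExp_of_forall_setIntegral_eq ((pastFiltration v hI.measurable).le k) hdraw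
    (fun _ _ _ => hmean.integrableOn) (fun s hs _ => ?_)
    (stronglyMeasurable_remainingMean v hI.measurable k).aestronglyMeasurable).symm
  have hzero := hI.setIntegral_sub_remainingMean_eq_zero hmN v k hs
  rw [integral_sub hdraw.integrableOn hmean.integrableOn, sub_eq_zero] at hzero
  exact hzero.symm

end Law

section SamplingMartingale

variable {Ω : Type*} {N m : ℕ} {I : Fin m → Ω → Fin N}
  {E : Type*} [NormedAddCommGroup E] [NormedSpace ℝ E] {v : Fin N → E}

/-- The displacement of the mean of the remaining vectors after `j` draws, constant from the
`m`-th draw on. It is the martingale to which the Bernstein inequality is applied. -/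
noncomputable def samplingMartingale (v : Fin N → E) (I : Fin m → Ω → Fin N) (j : ℕ) (ω : Ω) : E :=
  remainingMean v (fun k => I k ω) 0 - remainingMean v (fun k => I k ω) (min j m)

theorem samplingMartingale_zero : samplingMartingale v I 0 = 0 := by
  funext ω
  simp [samplingMartingale]

theorem samplingMartingale_length (hm : 0 < m) (hmN : m < N) (ω : Ω) :
    samplingMartingale v I m ω
      = ((m : ℝ) / (N - m)) • ((1 / (m : ℝ)) • ∑ k, v (I k ω) - (1 / (N : ℝ)) • ∑ i, v i) := by
  rw [samplingMartingale, min_self, remainingMean_zero_sub_length v _ hm hmN]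

theorem samplingMartingale_succ_of_le {k : ℕ} (hk : m ≤ k) :
    samplingMartingale v I (k + 1) = samplingMartingale v I k := by
  funext ω
  rw [samplingMartingale, samplingMartingale, min_eq_right hk, min_eq_right (by lia)]

theorem samplingMartingale_succ_sub_eq_remainingMean_sub (k : Fin m) (ω : Ω) :
    samplingMartingale v I (k + 1) ω - samplingMartingale v I k ω
      = remainingMean v (fun k => I k ω) k - remainingMean v (fun k => I k ω) (k + 1) := by
  rw [samplingMartingale, samplingMartingale, min_eq_left k.2, min_eq_left k.2.le,
    sub_sub_sub_cancel_left]

theorem samplingMartingale_succ_sub (hmN : m < N) (k : Fin m) (ω : Ω) :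
    samplingMartingale v I (k + 1) ω - samplingMartingale v I k ω
      = (1 / ((N : ℝ) - (k + 1))) • (v (I k ω) - remainingMean v (fun k => I k ω) k) := by
  rw [samplingMartingale_succ_sub_eq_remainingMean_sub, remainingMean_sub_succ v _ (by lia)]

variable {mΩ : MeasurableSpace Ω} {μ : Measure Ω}

theorem integrable_samplingMartingale [IsFiniteMeasure μ] (v : Fin N → E)
    (hI : ∀ k, Measurable (I k)) (j : ℕ) :
    Integrable (samplingMartingale v I j) μ :=
  integrable_comp_tuple hI fun a => remainingMean v a 0 - remainingMean v a (min j m)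

theorem stronglyAdapted_samplingMartingale (v : Fin N → E) (hI : ∀ k, Measurable (I k)) :
    StronglyAdapted (pastFiltration v hI) (samplingMartingale v I) := fun j =>
  ((stronglyMeasurable_remainingMean v hI 0).mono ((pastFiltration v hI).mono j.zero_le)).sub
    ((stronglyMeasurable_remainingMean v hI _).mono ((pastFiltration v hI).mono (min_le_left j m)))

variable [IsProbabilityMeasure μ]

theorem IsSamplingWithoutReplacement.ae_norm_samplingMartingale_succ_sub_le
    (hI : IsSamplingWithoutReplacement μ I) (hmN : m < N) {R : ℝ} (hR : 0 ≤ R)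
    (hv : ∀ i, ‖v i‖ ≤ R) (k : ℕ) :
    ∀ᵐ ω ∂μ, ‖samplingMartingale v I (k + 1) ω - samplingMartingale v I k ω‖
      ≤ 2 * R / (N - m + 1) := by
  have hmN' : (m : ℝ) < N := by exact_mod_cast hmN
  filter_upwards [hI.ae_injective hmN.le] with ω hω
  rcases lt_or_ge k m with hk | hk
  · have hk' : (k : ℝ) + 1 ≤ m := by exact_mod_cast hk
    rw [samplingMartingale_succ_sub_eq_remainingMean_sub ⟨k, hk⟩ ω]
    refine (norm_remainingMean_sub_succ_le hv ⟨_, hω⟩ (k := ⟨k, hk⟩) (by grind)).trans ?_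
    gcongr
    linarith
  · rw [samplingMartingale_succ_of_le hk, sub_self, norm_zero]
    have : 0 < (N : ℝ) - m + 1 := by linarith
    positivity

variable [CompleteSpace E]

theorem IsSamplingWithoutReplacement.condExp_samplingMartingale_succ_sub
    (hI : IsSamplingWithoutReplacement μ I) (hmN : m < N) (v : Fin N → E) (k : Fin m) :
    μ[fun ω => samplingMartingale v I (k + 1) ω - samplingMartingale v I k ω |
      pastFiltration v hI.measurable k] =ᵐ[μ] 0 := by
  simp only [samplingMartingale_succ_sub hmN]
  have hmean := integrable_comp_tuple (μ := μ) hI.measurable fun a => remainingMean v a k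
  filter_upwards [condExp_smul (μ := μ) (1 / ((N : ℝ) - (k + 1)))
      (fun ω => v (I k ω) - remainingMean v (fun k => I k ω) k)
      (pastFiltration v hI.measurable k),
    condExp_sub (integrable_comp_tuple (μ := μ) hI.measurable fun a => v (a k)) hmean
      (pastFiltration v hI.measurable k),
    hI.condExp_eq_remainingMean hmN.le v k] with ω hsmul hsub hdraw
  refine hsmul.trans (smul_eq_zero_of_right _ (hsub.trans ?_))
  rw [Pi.sub_apply, hdraw, condExp_of_stronglyMeasurable ((pastFiltration v hI.measurable).le k)
    (stronglyMeasurable_remainingMean v hI.measurable k) hmean, sub_self]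

theorem IsSamplingWithoutReplacement.martingale_samplingMartingale
    (hI : IsSamplingWithoutReplacement μ I) (hmN : m < N) (v : Fin N → E) :
    Martingale (samplingMartingale v I) (pastFiltration v hI.measurable) μ := by
  have hint := integrable_samplingMartingale (μ := μ) v hI.measurable
  refine martingale_of_condExp_sub_eq_zero_nat
    (stronglyAdapted_samplingMartingale v hI.measurable) hint fun k => ?_
  rcases lt_or_ge k m with hk | hk
  · exact hI.condExp_samplingMartingale_succ_sub hmN v ⟨k, hk⟩
  · rw [samplingMartingale_succ_of_le hk, sub_self, condExp_zero]

theorem IsSamplingWithoutReplacement.condExp_norm_samplingMartingale_succ_sub_sq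
    (hI : IsSamplingWithoutReplacement μ I) (hmN : m < N) (v : Fin N → E) (k : Fin m) :
    μ[fun ω => ‖samplingMartingale v I (k + 1) ω - samplingMartingale v I k ω‖ ^ 2 |
        pastFiltration v hI.measurable k]
      =ᵐ[μ] fun ω => stepWeight N k * stepVariance μ (fun k ω => v (I k ω)) k ω := by
  have hsq : (fun ω => ‖samplingMartingale v I (k + 1) ω - samplingMartingale v I k ω‖ ^ 2) =ᵐ[μ]
      stepWeight N k • fun ω => ‖v (I k ω) -
        (μ[fun ω => v (I k ω) | pastSigma (fun k ω => v (I k ω)) k]) ω‖ ^ 2 := by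
    filter_upwards [hI.condExp_eq_remainingMean hmN.le v k] with ω hω
    change (μ[fun ω => v (I k ω) | pastSigma (fun k ω => v (I k ω)) k]) ω = _ at hω
    rw [Pi.smul_apply, hω, samplingMartingale_succ_sub hmN, norm_smul, mul_pow,
      Real.norm_eq_abs, sq_abs, one_div_pow, stepWeight, smul_eq_mul]
  exact (condExp_congr_ae hsq).trans (condExp_smul _ _ _)

theorem IsSamplingWithoutReplacement.predictableVariation_samplingMartingale
    (hI : IsSamplingWithoutReplacement μ I) (hmN : m < N) (v : Fin N → E) :
    predictableVariation μ (pastFiltration v hI.measurable) (samplingMartingale v I) m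
      =ᵐ[μ] fun ω => ∑ k, stepWeight N k * stepVariance μ (fun k ω => v (I k ω)) k ω := by
  filter_upwards [ae_all_iff.2 (hI.condExp_norm_samplingMartingale_succ_sub_sq hmN v)] with ω hω
  simp only [predictableVariation, Finset.sum_range, hω]

end SamplingMartingale

section SamplingSigma

theorem one_div_sq_le_mul_sub {n x : ℝ} (hn : 0 < n) (hx : n ≤ x) :
    1 / x ^ 2 ≤ (n + 1) / n * (1 / x - 1 / (x + 1)) := by
  have hx0 : 0 < x := hn.trans_le hx
  rw [div_sub_div _ _ hx0.ne' (by positivity), div_mul_div_comm,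
    div_le_div_iff₀ (by positivity) (by positivity)]
  nlinarith [mul_nonneg (sq_nonneg x) (sub_nonneg.2 hx), hx0]

theorem stepWeight_pos {N m : ℕ} (hmN : m < N) (k : Fin m) : 0 < stepWeight N k := by
  have hk : (k : ℝ) + 1 < N := by exact_mod_cast (Nat.succ_le_of_lt k.2).trans_lt hmN
  exact one_div_pos.2 (pow_pos (sub_pos.2 hk) 2)

theorem sum_stepWeight_le {N m : ℕ} (hmN : m < N) :
    ∑ k : Fin m, stepWeight N k ≤ m * ((N : ℝ) - m + 1) / (((N : ℝ) - m) ^ 2 * N) := by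
  have hn : (0 : ℝ) < N - m := sub_pos.2 (by exact_mod_cast hmN)
  have hN : (0 : ℝ) < N := by exact_mod_cast m.zero_le.trans_lt hmN
  calc ∑ k : Fin m, stepWeight N k
      ≤ ∑ k : Fin m, ((N : ℝ) - m + 1) / (N - m) *
          (1 / ((N : ℝ) - (k + 1 : ℕ)) - 1 / ((N : ℝ) - (k : ℕ))) := by
        refine Finset.sum_le_sum fun k _ => ?_
        have hk : (k : ℝ) + 1 ≤ m := by exact_mod_cast k.2
        refine (one_div_sq_le_mul_sub hn (sub_le_sub_left hk _)).trans_eq ?_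
        rw [Nat.cast_succ, sub_add_eq_sub_sub, sub_add_cancel]
    _ = ((N : ℝ) - m + 1) / (N - m) * (1 / ((N : ℝ) - m) - 1 / N) := by
        rw [← Finset.mul_sum, Fin.sum_univ_eq_sum_range (fun k : ℕ =>
          1 / ((N : ℝ) - (k + 1 : ℕ)) - 1 / ((N : ℝ) - (k : ℕ))),
          Finset.sum_range_sub (fun k : ℕ => 1 / ((N : ℝ) - k)), Nat.cast_zero, sub_zero]
    _ = m * ((N : ℝ) - m + 1) / (((N : ℝ) - m) ^ 2 * N) := by
        field_simp
        ring

theorem ae_le_sq_toReal_eLpNorm_sqrt {Ω : Type*} [MeasurableSpace Ω] {μ : Measure Ω} {f : Ω → ℝ}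
    {C : ℝ} (hf : ∀ᵐ ω ∂μ, f ω ≤ C) :
    ∀ᵐ ω ∂μ, f ω ≤ (eLpNorm (fun ω => √(f ω)) ∞ μ).toReal ^ 2 := by
  rw [eLpNorm_exponent_top]
  have hfinite : eLpNormEssSup (fun ω => √(f ω)) μ ≠ ∞ :=
    (eLpNormEssSup_lt_top_of_ae_bound (C := √C) <| hf.mono fun ω hω => by
      rw [Real.norm_of_nonneg (Real.sqrt_nonneg _)]
      exact Real.sqrt_le_sqrt hω).ne
  filter_upwards [ae_le_eLpNormEssSup (μ := μ) (f := fun ω => √(f ω))] with ω hω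
  have hle := (ENNReal.toReal_le_toReal enorm_ne_top hfinite).2 hω
  rw [toReal_enorm, Real.norm_of_nonneg (Real.sqrt_nonneg _), Real.sqrt_le_iff] at hle
  exact hle.2

variable {Ω : Type*} [MeasurableSpace Ω] {μ : Measure Ω} {N m : ℕ}
  {E : Type*} [NormedAddCommGroup E] [NormedSpace ℝ E] [CompleteSpace E]

theorem ae_sum_stepWeight_mul_stepVariance_le {V : Fin m → Ω → E} {C : ℝ}
    (hW : 0 < ∑ k : Fin m, stepWeight N k)
    (hC : ∀ᵐ ω ∂μ, ∑ k, stepWeight N k * stepVariance μ V k ω ≤ C) :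
    ∀ᵐ ω ∂μ, ∑ k, stepWeight N k * stepVariance μ V k ω
      ≤ samplingSigma μ N V ^ 2 * ∑ k : Fin m, stepWeight N k := by
  filter_upwards [ae_le_sq_toReal_eLpNorm_sqrt hC] with ω hω
  rwa [samplingSigma, mul_pow, one_div_pow, Real.sq_sqrt hW.le, mul_right_comm,
    one_div_mul_cancel hW.ne', one_mul]

theorem IsSamplingWithoutReplacement.predictableVariation_samplingMartingale_le
    [IsProbabilityMeasure μ] {I : Fin m → Ω → Fin N} (hI : IsSamplingWithoutReplacement μ I)
    (hm : 0 < m) (hmN : m < N) (v : Fin N → E) :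
    ∀ᵐ ω ∂μ, predictableVariation μ (pastFiltration v hI.measurable) (samplingMartingale v I) m ω
      ≤ samplingSigma μ N (fun k ω => v (I k ω)) ^ 2 *
        (m * ((N : ℝ) - m + 1) / (((N : ℝ) - m) ^ 2 * N)) := by
  have hv : ∀ i, ‖v i‖ ≤ ⨆ i, ‖v i‖ := le_ciSup (Set.finite_range fun i => ‖v i‖).bddAbove
  have hW : 0 < ∑ k : Fin m, stepWeight N k :=
    Finset.sum_pos (fun k _ => stepWeight_pos hmN k) ⟨⟨0, hm⟩, Finset.mem_univ _⟩
  have hvariation := hI.predictableVariation_samplingMartingale hmN v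
  have hbounded := predictableVariation_le (F := pastFiltration v hI.measurable)
    (fun n => (integrable_samplingMartingale (μ := μ) v hI.measurable n).aestronglyMeasurable)
    (hI.ae_norm_samplingMartingale_succ_sub_le hmN (Real.iSup_nonneg fun i => norm_nonneg (v i)) hv)
    m
  filter_upwards [hvariation, ae_sum_stepWeight_mul_stepVariance_le hW
    (hvariation.symm.trans_le hbounded)] with ω heq hle
  rw [heq]
  exact hle.trans (mul_le_mul_of_nonneg_left (sum_stepWeight_le hmN) (sq_nonneg _))

/-- Taking `c = (n + 1) / (2 n)` turns the increment bound `a = 2 R / (n + 1)` into `c a = R / n`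
and cancels the factor `n + 1` of the bound on the sum of the weights. -/
theorem sampling_bernstein_exponent_eq {D σ R ε q M n : ℝ} (hM : 0 < M) (hn : 0 < n) :
    (M * ε / n) ^ 2 / (2 * (D ^ 2 * (σ ^ 2 * (M * (n + 1) / (n ^ 2 * q))) / ((n + 1) / (2 * n))
        + (n + 1) / (2 * n) * (2 * R / (n + 1)) * (M * ε / n) / 3))
      = M * ε ^ 2 / (2 * (2 * D ^ 2 * (n / q) * σ ^ 2 + ε * R / 3)) := by
  have hdenominator : 2 * (D ^ 2 * (σ ^ 2 * (M * (n + 1) / (n ^ 2 * q))) / ((n + 1) / (2 * n))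
        + (n + 1) / (2 * n) * (2 * R / (n + 1)) * (M * ε / n) / 3)
      = M / n ^ 2 * (2 * (2 * D ^ 2 * (n / q) * σ ^ 2 + ε * R / 3)) := by
    field_simp
  have hnumerator : (M * ε / n) ^ 2 = M / n ^ 2 * (M * ε ^ 2) := by ring
  rw [hdenominator, hnumerator, mul_div_mul_left _ _ (by positivity)]

theorem IsSamplingWithoutReplacement.measureReal_norm_sampleMean_sub_ge_le
    [IsProbabilityMeasure μ] {I : Fin m → Ω → Fin N} (hI : IsSamplingWithoutReplacement μ I)
    {D : ℝ} (hD : IsTwoSmooth E D) (hm : 0 < m) (hmN : m < N) {v : Fin N → E} {R : ℝ} (hR : 0 < R)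
    (hv : ∀ i, ‖v i‖ ≤ R) {ε : ℝ} (hε : 0 < ε) :
    μ.real {ω | ε ≤ ‖(1 / (m : ℝ)) • ∑ k, v (I k ω) - (1 / (N : ℝ)) • ∑ i, v i‖}
      ≤ 2 * Real.exp (-(m * ε ^ 2 / (2 * (2 * D ^ 2 * (((N : ℝ) - m) / N) *
        samplingSigma μ N (fun k ω => v (I k ω)) ^ 2 + ε * R / 3)))) := by
  have hm' : (0 : ℝ) < m := by exact_mod_cast hm
  have hn : (1 : ℝ) ≤ N - m := le_sub_iff_add_le'.2 (by exact_mod_cast hmN)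
  have hn0 : (0 : ℝ) < N - m := by linarith
  have hevent : {ω | ε ≤ ‖(1 / (m : ℝ)) • ∑ k, v (I k ω) - (1 / (N : ℝ)) • ∑ i, v i‖}
      = {ω | m * ε / ((N : ℝ) - m) ≤ ‖samplingMartingale v I m ω‖} := by
    ext ω
    have hscale : 0 < (m : ℝ) / (N - m) := by positivity
    rw [Set.mem_ofPred_eq, Set.mem_ofPred_eq, samplingMartingale_length hm hmN, norm_smul,
      Real.norm_of_nonneg hscale.le, mul_div_right_comm, mul_le_mul_iff_right₀ hscale]
  rw [hevent, ← sampling_bernstein_exponent_eq hm' hn0]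
  refine hD.measureReal_norm_ge_le_bernstein (hI.martingale_samplingMartingale hmN v)
    samplingMartingale_zero (by positivity)
    (hI.ae_norm_samplingMartingale_succ_sub_le hmN hR.le hv)
    (hI.predictableVariation_samplingMartingale_le hm hmN v) (by positivity) ?_ ?_
  · rw [div_le_div_iff₀ two_pos (by positivity)]
    linarith
  · rw [div_le_one (by positivity)]
    linarith

end SamplingSigma

theorem mainTheorem8 {E : Type*} [NormedAddCommGroup E] [NormedSpace ℝ E] [CompleteSpace E]
    (D : ℝ) (hD : IsTwoSmooth E D)
    {Ω : Type*} [MeasurableSpace Ω] (μ : Measure Ω) [IsProbabilityMeasure μ]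
    (N m : ℕ) (hm : 1 ≤ m) (hmN : m < N)
    (v : Fin N → E) (I : Fin m → Ω → Fin N) (hI : IsSamplingWithoutReplacement μ I)
    (ε : ℝ) (hε : 0 < ε) :
    μ.real {ω | ε ≤ ‖(1 / (m : ℝ)) • ∑ k : Fin m, v (I k ω) - (1 / (N : ℝ)) • ∑ i : Fin N, v i‖}
      ≤ 2 * Real.exp (-(m * ε ^ 2 /
          (2 * (2 * D ^ 2 * (((N : ℝ) - m) / N) * samplingSigma μ N (fun k ω => v (I k ω)) ^ 2
            + ε * (⨆ i : Fin N, ‖v i‖) / 3)))) := by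
  have hv : ∀ i, ‖v i‖ ≤ ⨆ i, ‖v i‖ := le_ciSup (Set.finite_range fun i => ‖v i‖).bddAbove
  rcases (Real.iSup_nonneg fun i => norm_nonneg (v i)).eq_or_lt with hR | hR
  · have hzero : ∀ i, v i = 0 := fun i => norm_le_zero_iff.1 ((hv i).trans hR.ge)
    have hempty : {ω | ε ≤ ‖(1 / (m : ℝ)) • ∑ k : Fin m, v (I k ω) -
        (1 / (N : ℝ)) • ∑ i : Fin N, v i‖} = ∅ := by
      simp [hzero, hε.not_ge]
    rw [hempty, measureReal_empty]
    positivity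
  · exact hI.measureReal_norm_sampleMean_sub_ge_le hD hm hmN hR hv hε
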